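/- Let $X$ be an infinite-dimensional separable Hilbert space over $\mathbb{K}=\mathbb{R}$ or $\mathbb{C}$, and let $M>1$. Let $\mathcal{B}(X)$ be the set of bounded linear operators on $X$ and $\mathcal{B}_M(X)=\{T\in\mathcal{B}(X):\|T\|\le M\}$. A set $S\subseteq X$ with at least two points is called uniformly Li-Yorke scrambled for $T\in\mathcal{B}(X)$ if there are sequences $(p_n)$ and $(q_n)$ in $\mathbb{N}$ such that for all $x,y\in S$ with $x\ne y$, $$\lim_{n\to\infty}\|T^{p_n}x-T^{p_n}y\|=0\quad\text{and}\quad\lim_{n\to\infty}\|T^{q_n}x-T^{q_n}y\|=\infty .$$ The operator $T$ is called densely uniformly Li-Yorke chaotic if there is a dense, uncountable subset of $X$ that is uniformly Li-Yorke scrambled for $T$; let $\mathrm{DULYC}(X)$ be the set of all such $T\in\mathcal{B}(X)$. The strong$^*$ operator topology (SOT$^*$) on $\mathcal{B}(X)$ is the topology in which each $T$ has as a neighborhood basis the sets $$\{S\in\mathcal{B}(X):\|Sx_i-Tx_i\|<\varepsilon,\ \|S^*x_i-T^*x_i\|<\varepsilon,\ i=1,\dots,n\},\qquad x_1,\dots,x_n\in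 X,\ \varepsilon>0,$$ where $T^*$ is the adjoint of $T$. Equip $\mathcal{B}_M(X)$ with the subspace topology of SOT$^*$. Then $\mathrm{DULYC}(X)\cap\mathcal{B}_M(X)$ is a dense $G_\delta$ subset of $\mathcal{B}_M(X)$. -/

import Mathlib

open Filter Topology

/-- A set `S` with at least two points is uniformly Li-Yorke scrambled for `f` if two sequences of
times `p`, `q` work simultaneously for all pairs of distinct points of `S`: along `p` the orbits
become asymptotic, along `q` their distance tends to infinity. -/
def IsUniformlyLiYorkeScrambled {X : Type*} [MetricSpace X] (f : X → X) (S : Set X) : Prop :=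
  S.Nontrivial ∧ ∃ p q : ℕ → ℕ, ∀ x ∈ S, ∀ y ∈ S, x ≠ y →
    Tendsto (fun n => dist (f^[p n] x) (f^[p n] y)) atTop (𝓝 0) ∧
    Tendsto (fun n => dist (f^[q n] x) (f^[q n] y)) atTop atTop

/-- `f` has a dense, uncountable, uniformly Li-Yorke scrambled set. -/
def IsDenselyUniformlyLiYorkeChaotic {X : Type*} [MetricSpace X] (f : X → X) : Prop :=
  ∃ S : Set X, Dense S ∧ ¬ S.Countable ∧ IsUniformlyLiYorkeScrambled f S

/-- The set `DULYC(X)` of all densely uniformly Li-Yorke chaotic bounded operators on `X`. -/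
def DULYC (𝕜 X : Type*) [RCLike 𝕜] [NormedAddCommGroup X] [InnerProductSpace 𝕜 X] :
    Set (X →L[𝕜] X) :=
  {T | IsDenselyUniformlyLiYorkeChaotic (T : X → X)}

/-- The strong* operator topology on bounded operators of a Hilbert space: the coarsest topology
for which all maps `T ↦ T x` and `T ↦ T* x` into `X` with its norm topology are continuous.
The lemma `strongStarTopology_mem_nhds_iff` describes its neighborhoods. -/
@[reducible] noncomputable def strongStarTopology (𝕜 X : Type*) [RCLike 𝕜] [NormedAddCommGroup X] [InnerProductSpace 𝕜 X]
    [CompleteSpace X] : TopologicalSpace (X →L[𝕜] X) :=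
  TopologicalSpace.induced
    (fun (T : X →L[𝕜] X) (x : X) => (T x, ContinuousLinearMap.adjoint T x)) inferInstance

/-- The basic neighborhoods of `T` are the sets of all `S` with `‖S x - T x‖ < ε` and
`‖S* x - T* x‖ < ε` for `x` in a finite set `F`. -/
theorem strongStarTopology_mem_nhds_iff {𝕜 X : Type*} [RCLike 𝕜] [NormedAddCommGroup X]
    [InnerProductSpace 𝕜 X] [CompleteSpace X] (T : X →L[𝕜] X) (V : Set (X →L[𝕜] X)) :
    V ∈ @nhds _ (strongStarTopology 𝕜 X) T ↔
      ∃ F : Finset X, ∃ ε : ℝ, 0 < ε ∧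
        {S : X →L[𝕜] X | ∀ x ∈ F, ‖S x - T x‖ < ε ∧
          ‖ContinuousLinearMap.adjoint S x - ContinuousLinearMap.adjoint T x‖ < ε} ⊆ V := by
  rw [strongStarTopology, nhds_induced, nhds_pi, Filter.mem_comap]
  constructor
  · rintro ⟨t, ht, htV⟩
    obtain ⟨I, hI, u, hu, hut⟩ := Filter.mem_pi.1 ht
    have h : ∀ x, ∃ ε : ℝ, 0 < ε ∧
        Metric.ball (T x, ContinuousLinearMap.adjoint T x) ε ⊆ u x :=
      fun x => Metric.mem_nhds_iff.1 (hu x)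
    choose e he heu using h
    have h2 : ∃ ε : ℝ, 0 < ε ∧ ∀ x ∈ hI.toFinset, ε ≤ e x := by
      generalize hI.toFinset = F
      classical
      induction F using Finset.induction_on with
      | empty => exact ⟨1, one_pos, by simp⟩
      | insert a F _ ih =>
        obtain ⟨ε, h0, h1⟩ := ih
        refine ⟨min ε (e a), lt_min h0 (he a), fun x hx => ?_⟩
        rcases Finset.mem_insert.1 hx with rfl | hx
        · exact min_le_right _ _
        · exact (min_le_left _ _).trans (h1 x hx)
    obtain ⟨ε, h0, h1⟩ := h2
    refine ⟨hI.toFinset, ε, h0, fun S hS => htV (hut fun x hx => heu x ?_)⟩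
    have hx' := hI.mem_toFinset.2 hx
    rw [Metric.mem_ball, Prod.dist_eq, max_lt_iff, dist_eq_norm, dist_eq_norm]
    exact ⟨(hS x hx').1.trans_le (h1 x hx'), (hS x hx').2.trans_le (h1 x hx')⟩
  · rintro ⟨F, ε, h0, hV⟩
    refine ⟨(F : Set X).pi fun x => Metric.ball (T x, ContinuousLinearMap.adjoint T x) ε,
      Filter.pi_mem_pi F.finite_toSet fun x _ => Metric.ball_mem_nhds _ h0, fun S hS => hV ?_⟩
    intro x hx
    have h := hS x hx
    rw [Metric.mem_ball, Prod.dist_eq, max_lt_iff, dist_eq_norm, dist_eq_norm] at h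
    exact h

/-- The ball `B_M(X)` of all bounded operators of norm at most `M`, as a set. -/
def operatorBall (𝕜 X : Type*) [RCLike 𝕜] [NormedAddCommGroup X] [InnerProductSpace 𝕜 X]
    (M : ℝ) : Set (X →L[𝕜] X) :=
  {T | ‖T‖ ≤ M}

/-- The subspace topology on `B_M(X)` inherited from the strong* operator topology. -/
@[reducible] noncomputable def strongStarBallTopology (𝕜 X : Type*) [RCLike 𝕜] [NormedAddCommGroup X]
    [InnerProductSpace 𝕜 X] [CompleteSpace X] (M : ℝ) :
    TopologicalSpace (operatorBall 𝕜 X M) :=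
  TopologicalSpace.induced Subtype.val (strongStarTopology 𝕜 X)

/-! Chaos in this sense is equivalent to `HasSmallPowers` along a dense sequence together with
`HasUnboundedPowers`. Both follow easily from a dense scrambled set. Conversely, Baire category is
applied to sequences of continuous maps from the Cantor space to `X`: for a generic sequence the
union of the images is dense and uncountable, and common times `p`, `q` contract and separate its
points (`isDenselyUniformlyLiYorkeChaotic_of_powers`).

Powers are strongly continuous on norm balls, so each condition is a countable intersection of open
ones there; this gives the Gδ part.

For density, `T` is approximated by `S = r PTP + M(ηP + VW)W`, with `V` a power of a unilateral
shift, `W = V*`, `P = 1 - VW` and `r² + η² = 1`. Cauchy–Schwarz gives `‖S‖ ≤ M`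
(`norm_shiftPerturbation_le`). Along the backward shift `S` multiplies norms by `M > 1`, so its
powers are unbounded. On `ker W` the powers grow at most like `(rM)^n`, while `η` feeds shifted
vectors into `ker W` with gain `M^n η`. As `r < 1`, a correction of size about `r^n` cancels an
orbit exactly (`hasSmallPowers_shiftPerturbation`). Finally `S → T` strong* when `W → 0` strongly,
`r → 1` and `η → 0`. -/

/-- Along the dense sequence `d`, finitely many terms can simultaneously be moved slightly to
vectors that a common power of `T` makes small. -/
def HasSmallPowers {𝕜 X : Type*} [RCLike 𝕜] [NormedAddCommGroup X] [InnerProductSpace 𝕜 X]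
    (d : ℕ → X) (T : X →L[𝕜] X) : Prop :=
  ∀ N : ℕ, ∃ p : ℕ, ∀ i ≤ N, ∃ y : X,
    ‖y - d i‖ < 1 / ((N : ℝ) + 1) ∧ ‖(T ^ p) y‖ < 1 / ((N : ℝ) + 1)

/-- The powers of `T` are not uniformly bounded. -/
def HasUnboundedPowers {𝕜 X : Type*} [RCLike 𝕜] [NormedAddCommGroup X] [InnerProductSpace 𝕜 X]
    (T : X →L[𝕜] X) : Prop :=
  ∀ N : ℕ, ∃ (q : ℕ) (x : X), (N : ℝ) * ‖x‖ < ‖(T ^ q) x‖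

/-! ### Moving finitely many vectors to contract or separate them -/

section Perturbation

variable {𝕜 X : Type*} [RCLike 𝕜] [NormedAddCommGroup X] [InnerProductSpace 𝕜 X]

theorem HasSmallPowers.exists_near {d : ℕ → X} (hd : DenseRange d) {T : X →L[𝕜] X}
    (hT : HasSmallPowers d T) {ι : Type*} (F : Finset ι) (w : ι → X) {ε : ℝ} (hε : 0 < ε) :
    ∃ (p : ℕ) (w' : ι → X), (∀ c, ‖w' c - w c‖ < ε) ∧ ∀ c ∈ F, ‖(T ^ p) (w' c)‖ < ε := by
  classical
  have h1 : ∀ c, ∃ i, ‖d i - w c‖ < ε / 2 := fun c => by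
    obtain ⟨i, hi⟩ := hd.exists_dist_lt (w c) (half_pos hε)
    exact ⟨i, by rwa [← dist_eq_norm, dist_comm]⟩
  choose e he using h1
  obtain ⟨N₀, hN₀⟩ := exists_nat_one_div_lt (half_pos hε)
  set N := max N₀ (F.sup e) with hN
  have hNε : 1 / ((N : ℝ) + 1) < ε / 2 := by
    refine lt_of_le_of_lt ?_ hN₀
    have : (N₀ : ℝ) ≤ N := by exact_mod_cast le_max_left _ _
    gcongr
  obtain ⟨p, hp⟩ := hT N
  have h2 : ∀ c, ∃ y, ‖y - w c‖ < ε ∧ (c ∈ F → ‖(T ^ p) y‖ < ε) := by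
    intro c
    by_cases hc : c ∈ F
    · obtain ⟨y, hy1, hy2⟩ := hp (e c) ((Finset.le_sup hc).trans (le_max_right _ _))
      refine ⟨y, ?_, fun _ => by linarith⟩
      have := norm_sub_le_norm_sub_add_norm_sub y (d (e c)) (w c)
      linarith [he c]
    · exact ⟨w c, by simpa using hε, fun h => absurd h hc⟩
  choose w' h3 h4 using h2
  exact ⟨p, w', h3, h4⟩

/-- Greedy choice by pigeonhole: among the `m + 1` candidate multiples of `v`, each earlier vector
excludes at most one, since the images of two candidates are at least `‖L v‖ / m > 2 * C` apart. -/
theorem exists_separated_translates (L : X →L[𝕜] X) (v : X) {ι : Type*} (w : ι → X) {C : ℝ}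
    {m : ℕ} (hm : 0 < m) (hv : 2 * C * m < ‖L v‖) (F : Finset ι) (hF : F.card ≤ m) :
    ∃ k : ι → ℕ, (∀ c, k c ≤ m) ∧ ∀ c ∈ F, ∀ c' ∈ F, c ≠ c' →
      C < ‖L ((w c + ((k c : 𝕜) / m) • v) - (w c' + ((k c' : 𝕜) / m) • v))‖ := by
  classical
  induction F using Finset.induction_on with
  | empty => exact ⟨fun _ => 0, by simp, by simp⟩
  | insert c F hc ih =>
    rw [Finset.card_insert_of_notMem hc] at hF
    obtain ⟨k, hk, hk'⟩ := ih (by omega)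
    have key : ∃ j ∈ Finset.range (m + 1), ∀ c' ∈ F,
        C < ‖L ((w c + ((j : 𝕜) / m) • v) - (w c' + ((k c' : 𝕜) / m) • v))‖ := by
      by_contra! h
      have : Nonempty ι := ⟨c⟩
      choose! g hg hgC using h
      obtain ⟨i, hi, j, hj, hij, hgij⟩ := Finset.exists_ne_map_eq_of_card_lt_of_maps_to
        (s := Finset.range (m + 1)) (t := F) (by simp; omega) hg
      have hi' := hgC i hi
      have hj' := hgC j hj
      rw [← hgij] at hj'
      have h1 := norm_sub_le (L ((w c + ((i : 𝕜) / m) • v) - (w (g i) + ((k (g i) : 𝕜) / m) • v)))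
        (L ((w c + ((j : 𝕜) / m) • v) - (w (g i) + ((k (g i) : 𝕜) / m) • v)))
      rw [← map_sub, sub_sub_sub_cancel_right, add_sub_add_left_eq_sub, ← sub_smul, map_smul,
        norm_smul, ← sub_div, norm_div, RCLike.norm_natCast] at h1
      have h2 : (1 : ℝ) ≤ ‖(i : 𝕜) - j‖ := by
        have h3 : ((i : 𝕜) - j) = ((((i : ℤ) - j : ℤ) : ℝ) : 𝕜) := by push_cast; rfl
        rw [h3, RCLike.norm_ofReal]
        have h4 : (1 : ℤ) ≤ |(i : ℤ) - j| := Int.one_le_abs (by omega)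
        exact_mod_cast h4
      have hm' : (0 : ℝ) < m := by exact_mod_cast hm
      have h5 : ‖L v‖ / m ≤ ‖(i : 𝕜) - j‖ / m * ‖L v‖ := by
        rw [div_mul_eq_mul_div]
        gcongr
        nlinarith [norm_nonneg (L v)]
      have h6 : ‖L v‖ / m ≤ 2 * C := by linarith
      rw [div_le_iff₀ hm'] at h6
      linarith
    obtain ⟨j, hj, hjC⟩ := key
    have hne : ∀ c' ∈ F, c' ≠ c := fun c' h h' => hc (h' ▸ h)
    refine ⟨Function.update k c j, fun c' => ?_, fun a ha b hb hab => ?_⟩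
    · by_cases h : c' = c
      · subst h; simpa [Nat.lt_succ_iff] using hj
      · simpa [h] using hk c'
    · rcases Finset.mem_insert.1 ha with rfl | ha' <;> rcases Finset.mem_insert.1 hb with rfl | hb'
      · exact absurd rfl hab
      · rw [Function.update_self, Function.update_of_ne (hne b hb')]
        exact hjC b hb'
      · rw [Function.update_self, Function.update_of_ne (hne a ha'), ← norm_neg, ← map_neg, neg_sub]
        exact hjC a ha'
      · rw [Function.update_of_ne (hne a ha'), Function.update_of_ne (hne b hb')]
        exact hk' a ha' b hb' hab

theorem HasUnboundedPowers.exists_near {T : X →L[𝕜] X} (hT : HasUnboundedPowers T) {ι : Type*}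
    (F : Finset ι) (w : ι → X) {ε : ℝ} (hε : 0 < ε) (C : ℝ) :
    ∃ (q : ℕ) (w' : ι → X), (∀ c, ‖w' c - w c‖ < ε) ∧
      ∀ c ∈ F, ∀ c' ∈ F, c ≠ c' → C < ‖(T ^ q) (w' c - w' c')‖ := by
  -- The extra `1` keeps `m` positive when `F` is empty.
  set m := F.card + 1 with hm
  have hm0 : (0 : ℝ) < m := by positivity
  obtain ⟨N, hN⟩ := exists_nat_gt (2 * C * m / (ε / 2))
  obtain ⟨q, x, hx⟩ := hT N
  have hx0 : 0 < ‖x‖ := by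
    rcases (norm_nonneg x).eq_or_lt with h | h
    · rw [norm_eq_zero.1 h.symm] at hx
      simp at hx
    · exact h
  -- Norm `ε / 2`, so that every translate by `(k / m) • v` with `k ≤ m` stays within `ε`.
  set v : X := ((ε / 2 / ‖x‖ : ℝ) : 𝕜) • x with hv
  have hs : ‖((ε / 2 / ‖x‖ : ℝ) : 𝕜)‖ = ε / 2 / ‖x‖ := by
    rw [RCLike.norm_ofReal, abs_of_pos (by positivity)]
  have hvn : ‖v‖ = ε / 2 := by
    rw [hv, norm_smul, hs]
    field_simp
  have hLv : 2 * C * m < ‖(T ^ q) v‖ := by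
    rw [hv, map_smul, norm_smul, hs]
    rw [div_lt_iff₀ (half_pos hε)] at hN
    have h1 : ε / 2 / ‖x‖ * (N * ‖x‖) < ε / 2 / ‖x‖ * ‖(T ^ q) x‖ := by gcongr
    have h2 : ε / 2 / ‖x‖ * (N * ‖x‖) = N * (ε / 2) := by field_simp
    linarith
  obtain ⟨k, hk, hkC⟩ := exists_separated_translates (T ^ q) v w (Nat.succ_pos _) hLv F
    (Nat.le_succ _)
  refine ⟨q, fun c => w c + ((k c : 𝕜) / m) • v, fun c => ?_, hkC⟩
  rw [add_sub_cancel_left, norm_smul, norm_div, RCLike.norm_natCast, RCLike.norm_natCast, hvn]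
  have h1 : (k c : ℝ) / m ≤ 1 := by
    rw [div_le_one hm0]
    exact_mod_cast hk c
  nlinarith

end Perturbation

/-! ### Sequences of continuous maps on the Cantor space -/

section CantorFamilies

/-- The first `m` coordinates of a binary sequence. -/
def cantorRestrict (m : ℕ) (a : ℕ → Bool) : Fin m → Bool := fun k => a k

theorem continuous_cantorRestrict (m : ℕ) : Continuous (cantorRestrict m) :=
  continuous_pi fun _ => continuous_apply _

/-- A finite binary word, extended by `false`. -/
def cantorExtend (m : ℕ) (c : Fin m → Bool) : ℕ → Bool :=
  fun k => if h : k < m then c ⟨k, h⟩ else false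

variable {X : Type*} [NormedAddCommGroup X]

/-- The family of locally constant functions on the Cantor space given by their values on the
cylinders of length `m`. -/
def cylinderFamily (m : ℕ) (w : ℕ × (Fin m → Bool) → X) (i : ℕ) : C(ℕ → Bool, X) where
  toFun a := w (i, cantorRestrict m a)
  continuous_toFun := (continuous_of_discreteTopology (f := fun c => w (i, c))).comp
    (continuous_cantorRestrict m)

/-- Truncating a binary sequence at length `m` leaves coordinate `k` unchanged once `m > k`, so
truncations of points near `a` converge to `a` jointly in `m` and the point. This yields locally
uniform convergence. -/
theorem tendsto_cylinderFamily (f : ℕ → C(ℕ → Bool, X)) :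
    Tendsto (fun m => cylinderFamily m fun c => f c.1 (cantorExtend m c.2)) atTop (𝓝 f) := by
  refine tendsto_pi_nhds.2 fun i => ?_
  rw [ContinuousMap.tendsto_iff_tendstoLocallyUniformly,
    tendstoLocallyUniformly_iff_forall_tendsto]
  intro a
  have h1 : Tendsto (fun y : ℕ × (ℕ → Bool) => f i y.2) (atTop ×ˢ 𝓝 a) (𝓝 (f i a)) :=
    ((f i).continuous.tendsto a).comp tendsto_snd
  have h2 : Tendsto (fun y : ℕ × (ℕ → Bool) => cantorExtend y.1 (cantorRestrict y.1 y.2))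
      (atTop ×ˢ 𝓝 a) (𝓝 a) := by
    refine tendsto_pi_nhds.2 fun k => ?_
    have h3 : Tendsto (fun y : ℕ × (ℕ → Bool) => y.2 k) (atTop ×ˢ 𝓝 a) (𝓝 (a k)) :=
      ((continuous_apply k).tendsto a).comp tendsto_snd
    refine h3.congr' ?_
    filter_upwards [tendsto_fst.eventually (eventually_gt_atTop k)] with y hy
    simp [cantorExtend, cantorRestrict, hy]
  have h4 := ((f i).continuous.tendsto a).comp h2
  have h5 := (h1.prodMk_nhds h4).mono_right (nhds_le_uniformity (f i a))
  exact h5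

theorem exists_forall_norm_sub_lt_mem {O : Set (ℕ → C(ℕ → Bool, X))} {g : ℕ → C(ℕ → Bool, X)}
    (hO : O ∈ 𝓝 g) :
    ∃ ε > 0, ∀ g' : ℕ → C(ℕ → Bool, X), (∀ i a, ‖g' i a - g i a‖ < ε) → g' ∈ O := by
  rw [nhds_pi, Filter.mem_pi] at hO
  obtain ⟨I, hI, t, ht, htO⟩ := hO
  have h1 : ∀ i, ∃ ε > 0, Metric.ball (g i) ε ⊆ t i := fun i => Metric.mem_nhds_iff.1 (ht i)
  choose e he heb using h1
  obtain ⟨ε, hε, hεe⟩ : ∃ ε > 0, ∀ i ∈ I, ε ≤ e i := by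
    rcases I.eq_empty_or_nonempty with rfl | hne
    · exact ⟨1, one_pos, by simp⟩
    · obtain ⟨i, _, hmin⟩ := hI.exists_minimalFor e I hne
      exact ⟨e i, he i, fun j hj => (le_total (e i) (e j)).elim id (hmin hj)⟩
  refine ⟨ε, hε, fun g' hg' => htO fun i hi => heb i ?_⟩
  refine Metric.ball_subset_ball (hεe i hi) ?_
  rw [Metric.mem_ball, ContinuousMap.dist_lt_iff hε]
  intro a
  rw [dist_eq_norm]
  exact hg' i a

/-- Reduces density to finite-level perturbations. Only levels `m ≥ n` matter, so that cylinders of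
length `m` refine those of length `n`. -/
theorem dense_of_perturb_cylinderFamily {U : Set (ℕ → C(ℕ → Bool, X))} (n : ℕ)
    (h : ∀ m ≥ n, ∀ w : ℕ × (Fin m → Bool) → X, ∀ ε > 0, ∃ w' : ℕ × (Fin m → Bool) → X,
      (∀ c, ‖w' c - w c‖ < ε) ∧ cylinderFamily m w' ∈ U) : Dense U := by
  intro f
  rw [mem_closure_iff_nhds]
  intro O hO
  have hO' := interior_mem_nhds.2 hO
  obtain ⟨m, hm, hmn⟩ :=
    (((tendsto_cylinderFamily f).eventually hO').and (eventually_ge_atTop n)).exists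
  obtain ⟨ε, hε, hε'⟩ := exists_forall_norm_sub_lt_mem (mem_interior_iff_mem_nhds.1 hm)
  obtain ⟨w', hw', hU⟩ := h m hmn (fun c => f c.1 (cantorExtend m c.2)) ε hε
  exact ⟨_, hε' _ fun i a => hw' (i, cantorRestrict m a), hU⟩

/-- The product topology controls only finitely many entries, so a far entry may be replaced by a
constant map. -/
theorem dense_setOf_exists_apply_mem {B : Set X} (hB : B.Nonempty) (a : ℕ → Bool) :
    Dense {f : ℕ → C(ℕ → Bool, X) | ∃ i, f i a ∈ B} := by
  obtain ⟨b, hb⟩ := hB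
  intro f
  refine mem_closure_of_tendsto (b := atTop)
    (f := fun i => Function.update f i (ContinuousMap.const _ b)) ?_ ?_
  · refine tendsto_pi_nhds.2 fun k => tendsto_const_nhds.congr' ?_
    filter_upwards [eventually_gt_atTop k] with i hi
    rw [Function.update_of_ne hi.ne]
  · exact Eventually.of_forall fun i => ⟨i, by simpa using hb⟩

theorem isOpen_setOf_exists_apply_mem {B : Set X} (hB : IsOpen B) (a : ℕ → Bool) :
    IsOpen {f : ℕ → C(ℕ → Bool, X) | ∃ i, f i a ∈ B} := by
  rw [Set.ofPred_exists]
  refine isOpen_iUnion fun i => hB.preimage ?_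
  exact (continuous_eval_const a).comp (continuous_apply i)

end CantorFamilies

/-! ### Chaos characterized by small and unbounded powers -/

section Characterization

variable {𝕜 X : Type*} [RCLike 𝕜] [NormedAddCommGroup X] [InnerProductSpace 𝕜 X]

theorem dist_iterate_eq_norm_pow_sub (T : X →L[𝕜] X) (n : ℕ) (x y : X) :
    dist (T^[n] x) (T^[n] y) = ‖(T ^ n) (x - y)‖ := by
  have h : ∀ x, (T ^ n) x = T^[n] x := by
    induction n with
    | zero => exact fun _ => rfl
    | succ n ih => exact fun x => by rw [pow_succ, mul_apply_eq_comp, ih]; rfl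
  rw [dist_eq_norm, map_sub, h, h]

/-- Pairs in different cylinders form a closed, hence compact, set, so a strict inequality on all of
them persists under small perturbations. -/
theorem isOpen_setOf_separating (L : X →L[𝕜] X) (n : ℕ) :
    IsOpen {f : ℕ → C(ℕ → Bool, X) | ∀ i ≤ n, ∀ j ≤ n, ∀ a b : ℕ → Bool,
      (i, cantorRestrict n a) ≠ (j, cantorRestrict n b) → (n : ℝ) < ‖L (f i a - f j b)‖} := by
  have key : ∀ i j, IsOpen {f : ℕ → C(ℕ → Bool, X) |
      ∀ z ∈ {z : (ℕ → Bool) × (ℕ → Bool) | (i, cantorRestrict n z.1) ≠ (j, cantorRestrict n z.2)},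
        (n : ℝ) < ‖L (f i z.1 - f j z.2)‖} := by
    intro i j
    have hcl : IsClosed {z : (ℕ → Bool) × (ℕ → Bool) |
        (i, cantorRestrict n z.1) ≠ (j, cantorRestrict n z.2)} :=
      (isClosed_discrete {c : (Fin n → Bool) × (Fin n → Bool) | (i, c.1) ≠ (j, c.2)}).preimage
        ((continuous_cantorRestrict n).prodMap (continuous_cantorRestrict n))
    refine isOpen_iff_mem_nhds.2 fun f hf =>
      hcl.isCompact.eventually_forall_of_forall_eventually fun z hz => ?_
    have hc : Continuous fun y : (ℕ → C(ℕ → Bool, X)) × ((ℕ → Bool) × (ℕ → Bool)) =>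
        ‖L (y.1 i y.2.1 - y.1 j y.2.2)‖ := by
      have h1 : ∀ i, Continuous fun y : (ℕ → C(ℕ → Bool, X)) × ((ℕ → Bool) × (ℕ → Bool)) =>
        y.1 i := fun i => (continuous_apply i).comp continuous_fst
      exact (L.continuous.comp (((h1 i).eval (continuous_fst.comp continuous_snd)).sub
        ((h1 j).eval (continuous_snd.comp continuous_snd)))).norm
    exact hc.continuousAt.eventually (lt_mem_nhds (hf z hz))
  have : {f : ℕ → C(ℕ → Bool, X) | ∀ i ≤ n, ∀ j ≤ n, ∀ a b : ℕ → Bool,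
      (i, cantorRestrict n a) ≠ (j, cantorRestrict n b) → (n : ℝ) < ‖L (f i a - f j b)‖} =
      ⋂ i ∈ Set.Iic n, ⋂ j ∈ Set.Iic n, {f : ℕ → C(ℕ → Bool, X) |
      ∀ z ∈ {z : (ℕ → Bool) × (ℕ → Bool) | (i, cantorRestrict n z.1) ≠ (j, cantorRestrict n z.2)},
        (n : ℝ) < ‖L (f i z.1 - f j z.2)‖} := by
    ext f
    simp
  rw [this]
  exact (Set.finite_Iic n).isOpen_biInter fun i _ =>
    (Set.finite_Iic n).isOpen_biInter fun j _ => key i j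

theorem isOpen_setOf_forall_norm_lt (L : X →L[𝕜] X) (n : ℕ) (ε : ℝ) :
    IsOpen {f : ℕ → C(ℕ → Bool, X) | ∀ i ≤ n, ∀ a : ℕ → Bool, ‖L (f i a)‖ < ε} := by
  have key : ∀ i, IsOpen {f : ℕ → C(ℕ → Bool, X) | ∀ a ∈ Set.univ, ‖L (f i a)‖ < ε} := by
    intro i
    refine isOpen_iff_mem_nhds.2 fun f hf =>
      isCompact_univ.eventually_forall_of_forall_eventually fun z hz => ?_
    have hc : Continuous fun y : (ℕ → C(ℕ → Bool, X)) × (ℕ → Bool) => ‖L (y.1 i y.2)‖ :=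
      (L.continuous.comp (((continuous_apply i).comp continuous_fst).eval continuous_snd)).norm
    exact hc.continuousAt.eventually (gt_mem_nhds (hf z hz))
  have : {f : ℕ → C(ℕ → Bool, X) | ∀ i ≤ n, ∀ a : ℕ → Bool, ‖L (f i a)‖ < ε} =
      ⋂ i ∈ Set.Iic n, {f : ℕ → C(ℕ → Bool, X) | ∀ a ∈ Set.univ, ‖L (f i a)‖ < ε} := by
    ext f
    simp
  rw [this]
  exact (Set.finite_Iic n).isOpen_biInter fun i _ => key i

theorem HasUnboundedPowers.dense_separating {T : X →L[𝕜] X} (hT : HasUnboundedPowers T) (n : ℕ) :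
    Dense {f : ℕ → C(ℕ → Bool, X) | ∃ q, ∀ i ≤ n, ∀ j ≤ n, ∀ a b : ℕ → Bool,
      (i, cantorRestrict n a) ≠ (j, cantorRestrict n b) →
        (n : ℝ) < ‖(T ^ q) (f i a - f j b)‖} := by
  refine dense_of_perturb_cylinderFamily n fun m hm w ε hε => ?_
  obtain ⟨q, w', hw', hq⟩ :=
    hT.exists_near (Finset.range (n + 1) ×ˢ Finset.univ) w hε (n : ℝ)
  refine ⟨w', hw', q, fun i hi j hj a b hab => ?_⟩
  refine hq _ (by simpa [Nat.lt_succ_iff] using hi) _ (by simpa [Nat.lt_succ_iff] using hj)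
    fun h => hab ?_
  rw [Prod.mk.injEq] at h ⊢
  exact ⟨h.1, funext fun k => congrFun h.2 ⟨k, k.2.trans_le hm⟩⟩

theorem HasSmallPowers.dense_small {d : ℕ → X} (hd : DenseRange d) {T : X →L[𝕜] X}
    (hT : HasSmallPowers d T) (n : ℕ) {δ : ℝ} (hδ : 0 < δ) :
    Dense {f : ℕ → C(ℕ → Bool, X) | ∃ p, ∀ i ≤ n, ∀ a : ℕ → Bool, ‖(T ^ p) (f i a)‖ < δ} := by
  refine dense_of_perturb_cylinderFamily 0 fun m _ w ε hε => ?_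
  obtain ⟨p, w', hw', hp⟩ :=
    hT.exists_near hd (Finset.range (n + 1) ×ˢ Finset.univ) w (lt_min hε hδ)
  refine ⟨w', fun c => (hw' c).trans_le (min_le_left _ _), p, fun i hi a => ?_⟩
  exact (hp _ (by simpa [Nat.lt_succ_iff] using hi)).trans_le (min_le_right _ _)

theorem isDenselyUniformlyLiYorkeChaotic_of_powers [CompleteSpace X]
    {d : ℕ → X} (hd : DenseRange d) {T : X →L[𝕜] X}
    (hA : HasSmallPowers d T) (hB : HasUnboundedPowers T) :
    IsDenselyUniformlyLiYorkeChaotic (T : X → X) := by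
  have hpos : ∀ n : ℕ, (0 : ℝ) < 1 / ((n : ℝ) + 1) := fun n => Nat.one_div_pos_of_nat
  have hU : ∀ᶠ f in residual (ℕ → C(ℕ → Bool, X)), ∀ n : ℕ, ∃ q, ∀ i ≤ n, ∀ j ≤ n,
      ∀ a b : ℕ → Bool, (i, cantorRestrict n a) ≠ (j, cantorRestrict n b) →
        (n : ℝ) < ‖(T ^ q) (f i a - f j b)‖ :=
    eventually_countable_forall.2 fun n => residual_of_dense_open (by
      rw [Set.ofPred_exists]
      exact isOpen_iUnion fun q => isOpen_setOf_separating (T ^ q) n) (hB.dense_separating n)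
  have hV : ∀ᶠ f in residual (ℕ → C(ℕ → Bool, X)), ∀ n : ℕ, ∃ p, ∀ i ≤ n, ∀ a : ℕ → Bool,
      ‖(T ^ p) (f i a)‖ < 1 / ((n : ℝ) + 1) :=
    eventually_countable_forall.2 fun n => residual_of_dense_open (by
      rw [Set.ofPred_exists]
      exact isOpen_iUnion fun p => isOpen_setOf_forall_norm_lt (T ^ p) n _)
      (hA.dense_small hd n (hpos n))
  have hD : ∀ᶠ f in residual (ℕ → C(ℕ → Bool, X)), ∀ k : ℕ × ℕ, ∃ i,
      f i (fun _ => false) ∈ Metric.ball (d k.1) (1 / ((k.2 : ℝ) + 1)) :=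
    eventually_countable_forall.2 fun k => residual_of_dense_open
      (isOpen_setOf_exists_apply_mem Metric.isOpen_ball _)
      (dense_setOf_exists_apply_mem ⟨d k.1, Metric.mem_ball_self (hpos k.2)⟩ _)
  obtain ⟨f, ⟨hfU, hfV⟩, hfD⟩ := (dense_of_mem_residual ((hU.and hV).and hD)).nonempty
  choose q hq using hfU
  choose p hp using hfV
  -- A single injective member already makes the union of the images uncountable.
  have hinj : Function.Injective (f 0) := by
    intro a b hab
    by_contra hne
    obtain ⟨k, hk⟩ := Function.ne_iff.1 hne
    -- Words of length `k + 1` are the first to see coordinate `k`.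
    have h := hq (k + 1) 0 (Nat.zero_le _) 0 (Nat.zero_le _) a b fun h =>
      hk (congrFun (Prod.mk.inj h).2 ⟨k, k.lt_succ_self⟩)
    rw [hab, sub_self, map_zero, norm_zero] at h
    exact absurd h (not_lt.2 (Nat.cast_nonneg _))
  have hunc : ¬ (⋃ i, Set.range (f i)).Countable := by
    intro h
    have h0 : (Set.range (f 0)).Countable := h.mono (Set.subset_iUnion (fun i => Set.range (f i)) 0)
    have := h0.to_subtype
    have h1 : Countable (ℕ → Bool) :=
      Function.Injective.countable (Set.rangeFactorization_injective.2 hinj)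
    obtain ⟨g, hg⟩ := exists_surjective_nat (ℕ → Bool)
    obtain ⟨n, hn⟩ := hg fun k => !g k k
    simpa using congrFun hn n
  refine ⟨⋃ i, Set.range (f i), ?_, hunc, ?_, p, q, ?_⟩
  · refine Metric.dense_iff.2 fun x ε hε => ?_
    obtain ⟨n, hn⟩ := hd.exists_dist_lt x (half_pos hε)
    obtain ⟨m, hm⟩ := exists_nat_one_div_lt (half_pos hε)
    obtain ⟨i, hi⟩ := hfD (n, m)
    refine ⟨f i fun _ => false, ?_, Set.mem_iUnion.2 ⟨i, _, rfl⟩⟩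
    rw [Metric.mem_ball] at hi ⊢
    rw [dist_comm] at hn
    linarith [dist_triangle (f i fun _ => false) (d n) x]
  · exact Set.not_subsingleton_iff.1 fun h => hunc h.countable
  · intro x hx y hy hxy
    obtain ⟨i, a, rfl⟩ := Set.mem_iUnion.1 hx
    obtain ⟨j, b, rfl⟩ := Set.mem_iUnion.1 hy
    simp only [dist_iterate_eq_norm_pow_sub]
    constructor
    · have h1 : Tendsto (fun n : ℕ => 2 * (1 / ((n : ℝ) + 1))) atTop (𝓝 0) := by
        simpa using tendsto_one_div_add_atTop_nhds_zero_nat.const_mul (2 : ℝ)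
      refine squeeze_zero' (Eventually.of_forall fun _ => norm_nonneg _) ?_ h1
      filter_upwards [eventually_ge_atTop i, eventually_ge_atTop j] with n hi hj
      rw [map_sub]
      linarith [norm_sub_le ((T ^ p n) (f i a)) ((T ^ p n) (f j b)), hp n i hi a, hp n j hj b]
    -- Distinct points carry labels that differ at every sufficiently large level, so the same times
    -- `q n` serve all pairs.
    · have h1 : ∀ᶠ n in atTop, (i, cantorRestrict n a) ≠ (j, cantorRestrict n b) := by
        by_cases hij : i = j
        · subst hij
          obtain ⟨k, hk⟩ := Function.ne_iff.1 fun h : a = b => hxy (by rw [h])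
          filter_upwards [eventually_gt_atTop k] with n hn h
          exact hk (congrFun (Prod.mk.inj h).2 ⟨k, hn⟩)
        · exact Eventually.of_forall fun n h => hij (Prod.mk.inj h).1
      refine tendsto_atTop_mono' _ ?_ tendsto_natCast_atTop_atTop
      filter_upwards [eventually_ge_atTop i, eventually_ge_atTop j, h1] with n hi hj hn
      exact (hq n i hi j hj a b hn).le

/-- Translating the scrambled set by one of its points `s` keeps it dense, and the powers along `p`
send every translated point to zero. -/
theorem HasSmallPowers.of_scrambled {d : ℕ → X} {T : X →L[𝕜] X}
    (hT : IsDenselyUniformlyLiYorkeChaotic (T : X → X)) : HasSmallPowers d T := by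
  obtain ⟨S, hS, -, hSn, p, q, hpq⟩ := hT
  obtain ⟨s, hs⟩ := hSn.nonempty
  intro N
  have hpos : (0 : ℝ) < 1 / ((N : ℝ) + 1) := Nat.one_div_pos_of_nat
  have h1 : ∀ i, ∃ x ∈ S, ‖x - s - d i‖ < 1 / ((N : ℝ) + 1) := fun i => by
    obtain ⟨x, hx, hxd⟩ := hS.exists_dist_lt (d i + s) hpos
    refine ⟨x, hx, ?_⟩
    rwa [dist_comm, dist_eq_norm, add_comm, ← sub_sub] at hxd
  choose x hxS hxd using h1
  have h2 : ∀ i, Tendsto (fun n => ‖(T ^ p n) (x i - s)‖) atTop (𝓝 0) := fun i => by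
    by_cases hxs : x i = s
    · simp [hxs]
    · refine (hpq _ (hxS i) _ hs hxs).1.congr fun n => ?_
      exact dist_iterate_eq_norm_pow_sub T _ _ _
  have h3 : ∀ᶠ n in atTop, ∀ i ∈ Set.Iic N, ‖(T ^ p n) (x i - s)‖ < 1 / ((N : ℝ) + 1) :=
    (Filter.eventually_all_finite (Set.finite_Iic N)).2 fun i _ =>
      (h2 i).eventually (gt_mem_nhds hpos)
  obtain ⟨n, hn⟩ := h3.exists
  exact ⟨p n, fun i hi => ⟨x i - s, hxd i, hn i hi⟩⟩

theorem HasUnboundedPowers.of_scrambled {T : X →L[𝕜] X}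
    (hT : IsDenselyUniformlyLiYorkeChaotic (T : X → X)) : HasUnboundedPowers T := by
  obtain ⟨S, -, -, ⟨x, hx, y, hy, hxy⟩, p, q, hpq⟩ := hT
  intro N
  obtain ⟨n, hn⟩ := ((hpq x hx y hy hxy).2.eventually_gt_atTop ((N : ℝ) * ‖x - y‖)).exists
  refine ⟨q n, x - y, ?_⟩
  rwa [← dist_iterate_eq_norm_pow_sub]

end Characterization

/-! ### Unilateral shifts on separable Hilbert spaces -/

section Shift

variable {𝕜 X : Type*} [RCLike 𝕜] [NormedAddCommGroup X] [InnerProductSpace 𝕜 X]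

theorem exists_hilbertBasis_nat [CompleteSpace X] [TopologicalSpace.SeparableSpace X]
    (hX : ¬ FiniteDimensional 𝕜 X) : Nonempty (HilbertBasis ℕ 𝕜 X) := by
  obtain ⟨w, b, hb⟩ := exists_hilbertBasis 𝕜 X
  have hcount : Countable w := by
    -- Uniformly separated basis vectors give disjoint balls, of which a separable space has only
    -- countably many.
    have hdist : ∀ i j : w, i ≠ j → 1 ≤ dist (b i) (b j) := by
      intro i j hij
      have h := norm_sub_sq (𝕜 := 𝕜) (b i) (b j)
      rw [b.orthonormal.1 i, b.orthonormal.1 j, b.orthonormal.2 hij, map_zero] at h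
      rw [dist_eq_norm]
      nlinarith [norm_nonneg (b i - b j)]
    refine (Pairwise.countable_of_isOpen_disjoint (s := fun i : w => Metric.ball (b i) (1 / 2))
      (fun i j hij => ?_) (fun _ => Metric.isOpen_ball)
      fun i => ⟨b i, Metric.mem_ball_self (by norm_num)⟩)
    exact Metric.ball_disjoint_ball (by linarith [hdist i j hij])
  have hinf : Infinite w := by
    by_contra h
    rw [not_infinite_iff_finite] at h
    have := Fintype.ofFinite w
    exact hX b.toOrthonormalBasis.toBasis.finiteDimensional_of_finite
  obtain ⟨e⟩ := nonempty_equiv_of_countable (α := ℕ) (β := w)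
  refine ⟨HilbertBasis.mk (b.orthonormal.comp e e.injective) ?_⟩
  rw [e.surjective.range_comp]
  exact b.dense_span.ge

/-- Every infinite-dimensional separable Hilbert space carries a unilateral shift. -/
theorem exists_unilateral_shift [CompleteSpace X] [TopologicalSpace.SeparableSpace X]
    (hX : ¬ FiniteDimensional 𝕜 X) :
    ∃ V : X →ₗᵢ[𝕜] X, ∀ x : X, Tendsto
      (fun n => (ContinuousLinearMap.adjoint V.toContinuousLinearMap ^ n) x) atTop (𝓝 0) := by
  obtain ⟨b⟩ := exists_hilbertBasis_nat hX
  have ho : Orthonormal 𝕜 fun i => b (i + 1) :=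
    b.orthonormal.comp (fun i => i + 1) (add_left_injective 1)
  let V : X →ₗᵢ[𝕜] X := ho.orthogonalFamily.linearIsometry.comp b.repr.toLinearIsometry
  have hV : ∀ i, V (b i) = b (i + 1) := fun i => by
    classical
    simp [V, b.repr_self, OrthogonalFamily.linearIsometry_apply_single]
  refine ⟨V, ?_⟩
  set W := ContinuousLinearMap.adjoint V.toContinuousLinearMap with hW
  have hWV : ∀ x, W (V x) = x := fun x => by
    refine ext_inner_right 𝕜 fun y => ?_
    rw [hW, ContinuousLinearMap.adjoint_inner_left]
    exact V.inner_map_map x y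
  have hW1 : ‖W‖ ≤ 1 := by
    rw [hW, LinearIsometryEquiv.norm_map]
    exact V.norm_toContinuousLinearMap_le
  have hWn : ∀ n, ‖W ^ n‖ ≤ 1 := fun n => by
    induction n with
    | zero => exact ContinuousLinearMap.norm_id_le
    | succ n ih =>
      rw [pow_succ]
      exact (norm_mul_le _ _).trans (mul_le_one₀ ih (norm_nonneg _) hW1)
  have hW0 : W (b 0) = 0 := by
    have h1 : ∀ j, inner 𝕜 (b j) (W (b 0)) = 0 := fun j => by
      rw [hW, ContinuousLinearMap.adjoint_inner_right]
      change inner 𝕜 (V (b j)) (b 0) = 0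
      rw [hV]
      exact b.orthonormal.2 (by omega)
    apply b.repr.injective
    ext j
    rw [b.repr_apply_apply, h1, map_zero]
    rfl
  have hWb : ∀ i n, i < n → (W ^ n) (b i) = 0 := by
    intro i
    induction i with
    | zero =>
      intro n hn
      obtain ⟨k, rfl⟩ := Nat.exists_eq_succ_of_ne_zero hn.ne'
      rw [pow_succ, mul_apply_eq_comp, hW0, map_zero]
    | succ i ih =>
      intro n hn
      obtain ⟨k, rfl⟩ := Nat.exists_eq_succ_of_ne_zero (Nat.ne_zero_of_lt hn)
      rw [pow_succ, mul_apply_eq_comp, ← hV, hWV]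
      exact ih k (by omega)
  -- Powers of `W` eventually kill each basis vector; the bound `‖W ^ n‖ ≤ 1` then carries
  -- convergence from the span to its closure.
  have hspan : ∀ y ∈ Submodule.span 𝕜 (Set.range b),
      Tendsto (fun n => (W ^ n) y) atTop (𝓝 0) := by
    intro y hy
    induction hy using Submodule.span_induction with
    | mem y hy =>
      obtain ⟨i, rfl⟩ := hy
      refine tendsto_const_nhds.congr' ?_
      filter_upwards [eventually_gt_atTop i] with n hn
      exact (hWb i n hn).symm
    | zero => simp
    | add y z _ _ hy hz => simpa using hy.add hz
    | smul c y _ hy => simpa using hy.const_smul c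
  intro x
  rw [Metric.tendsto_atTop]
  intro ε hε
  have hx : x ∈ (Submodule.span 𝕜 (Set.range b)).topologicalClosure := by
    rw [b.dense_span]; trivial
  obtain ⟨y, hy, hxy⟩ := Metric.mem_closure_iff.1 hx (ε / 2) (half_pos hε)
  obtain ⟨N, hN⟩ := Metric.tendsto_atTop.1 (hspan y hy) (ε / 2) (half_pos hε)
  refine ⟨N, fun n hn => ?_⟩
  have h1 := hN n hn
  rw [dist_zero_right] at h1 ⊢
  have h2 : ‖(W ^ n) (x - y)‖ ≤ ‖x - y‖ :=
    ((W ^ n).le_of_opNorm_le (hWn n) _).trans (one_mul _).le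
  rw [dist_eq_norm] at hxy
  have h3 : (W ^ n) x = (W ^ n) (x - y) + (W ^ n) y := by rw [map_sub, sub_add_cancel]
  rw [h3]
  linarith [norm_add_le ((W ^ n) (x - y)) ((W ^ n) y)]

end Shift

/-! ### Dynamics of the shift perturbation -/

section Model

variable {𝕜 X : Type*} [RCLike 𝕜] [NormedAddCommGroup X] [InnerProductSpace 𝕜 X]

/-- Given an isometry `V` with left inverse `W` and the projection `P = 1 - V W` onto the kernel
of `W`, the compression `r P T P` coupled with `M` times the backward shift `W`. -/
noncomputable def shiftPerturbation (V W T : X →L[𝕜] X) (M r η : ℝ) : X →L[𝕜] X :=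
  (r : 𝕜) • ((1 - V * W) * T * (1 - V * W)) +
    (M : 𝕜) • (((η : 𝕜) • (1 - V * W) + V * W) * W)

variable {V W T : X →L[𝕜] X} {M r η : ℝ}

theorem shiftPerturbation_apply (x : X) : shiftPerturbation V W T M r η x =
    (r : 𝕜) • (T (x - V (W x)) - V (W (T (x - V (W x))))) +
      (M : 𝕜) • ((η : 𝕜) • (W x - V (W (W x))) + V (W (W x))) := by
  simp [shiftPerturbation]

theorem shiftPerturbation_apply_of_ker {x : X} (h : W x = 0) :
    shiftPerturbation V W T M r η x = (r : 𝕜) • (T x - V (W (T x))) := by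
  simp [shiftPerturbation, h]

theorem shiftPerturbation_apply_isometry (hWV : ∀ x, W (V x) = x) (x : X) :
    shiftPerturbation V W T M r η (V x) =
      (M : 𝕜) • ((η : 𝕜) • (x - V (W x)) + V (W x)) := by
  simp [shiftPerturbation, hWV]

theorem leftInverse_shiftPerturbation (hWV : ∀ x, W (V x) = x) (x : X) :
    W (shiftPerturbation V W T M r η x) = (M : 𝕜) • W (W x) := by
  simp [shiftPerturbation, hWV]

theorem leftInverse_shiftPerturbation_pow (hWV : ∀ x, W (V x) = x) (n : ℕ) (x : X) :
    W ((shiftPerturbation V W T M r η ^ n) x) = (M : 𝕜) ^ n • (W ^ (n + 1)) x := by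
  induction n generalizing x with
  | zero => simp
  | succ n ih =>
    rw [pow_succ', mul_apply_eq_comp, leftInverse_shiftPerturbation hWV, ih, map_smul, smul_smul,
      ← pow_succ', pow_succ' W (n + 1), mul_apply_eq_comp]

theorem shiftPerturbation_pow_isometry_pow (hWV : ∀ x, W (V x) = x) (n : ℕ) (x : X) :
    (shiftPerturbation V W T M r η ^ n) ((V ^ (n + 1)) x) = (M : 𝕜) ^ n • V x := by
  induction n with
  | zero => simp
  | succ n ih =>
    rw [pow_succ, mul_apply_eq_comp, pow_succ' V, mul_apply_eq_comp,
      shiftPerturbation_apply_isometry hWV, pow_succ' V n, mul_apply_eq_comp, hWV, sub_self,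
      smul_zero, zero_add, map_smul, ← mul_apply_eq_comp V, ← pow_succ', ih, smul_smul, ← pow_succ']

theorem shiftPerturbation_pow_succ_isometry_pow (hWV : ∀ x, W (V x) = x) (n : ℕ) {x : X}
    (hx : W x = 0) :
    (shiftPerturbation V W T M r η ^ (n + 1)) ((V ^ (n + 1)) x) =
      ((M : 𝕜) ^ (n + 1) * (η : 𝕜)) • x := by
  rw [pow_succ', mul_apply_eq_comp, shiftPerturbation_pow_isometry_pow hWV, map_smul,
    shiftPerturbation_apply_isometry hWV, hx, map_zero, sub_zero, add_zero, smul_smul, smul_smul,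
    pow_succ, mul_assoc]

theorem hasUnboundedPowers_shiftPerturbation [Nontrivial X] (hV : ∀ x, ‖V x‖ = ‖x‖)
    (hWV : ∀ x, W (V x) = x) (hM : 1 < M) :
    HasUnboundedPowers (shiftPerturbation V W T M r η) := by
  intro N
  obtain ⟨x, hx⟩ := exists_ne (0 : X)
  obtain ⟨q, hq⟩ := pow_unbounded_of_one_lt (N : ℝ) hM
  have hVn : ∀ n, ‖(V ^ n) x‖ = ‖x‖ := fun n => by
    induction n with
    | zero => simp
    | succ n ih => rw [pow_succ', mul_apply_eq_comp, hV, ih]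
  refine ⟨q, (V ^ (q + 1)) x, ?_⟩
  rw [shiftPerturbation_pow_isometry_pow hWV, hVn, norm_smul, hV, norm_pow, RCLike.norm_ofReal,
    abs_of_pos (one_pos.trans hM)]
  exact mul_lt_mul_of_pos_right hq (norm_pos_iff.2 hx)

/-- The kernel of `W` is invariant, and there the operator is `r` times the compression of `T`. -/
theorem norm_shiftPerturbation_pow_of_ker (hWV : ∀ x, W (V x) = x)
    (hP : ∀ x, ‖x - V (W x)‖ ≤ ‖x‖) (hT : ‖T‖ ≤ M) (hr : 0 ≤ r) (n : ℕ) {x : X} (hx : W x = 0) :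
    ‖(shiftPerturbation V W T M r η ^ n) x‖ ≤ (r * M) ^ n * ‖x‖ := by
  have hM : 0 ≤ M := (norm_nonneg T).trans hT
  induction n with
  | zero => simp
  | succ n ih =>
    rw [pow_succ', mul_apply_eq_comp, shiftPerturbation_apply_of_ker, norm_smul,
      RCLike.norm_ofReal, abs_of_nonneg hr, pow_succ', mul_assoc, mul_assoc]
    · refine mul_le_mul_of_nonneg_left ((hP _).trans ((T.le_of_opNorm_le hT _).trans ?_)) hr
      gcongr
    · rw [leftInverse_shiftPerturbation_pow hWV, pow_succ W, mul_apply_eq_comp, hx, map_zero,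
        smul_zero]

theorem hasSmallPowers_shiftPerturbation (hV : ∀ x, ‖V x‖ = ‖x‖)
    (hWV : ∀ x, W (V x) = x) (hP : ∀ x, ‖x - V (W x)‖ ≤ ‖x‖)
    (hW : ∀ x, Tendsto (fun n => (W ^ n) x) atTop (𝓝 0)) (hT : ‖T‖ ≤ M)
    (hM : 1 < M) (hr : 0 ≤ r) (hr1 : r < 1) (hη : 0 < η) (d : ℕ → X) :
    HasSmallPowers d (shiftPerturbation V W T M r η) := by
  set S := shiftPerturbation V W T M r η with hS
  have hM0 : 0 < M := one_pos.trans hM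
  have hVn : ∀ n x, ‖(V ^ n) x‖ = ‖x‖ := fun n x => by
    induction n with
    | zero => simp
    | succ n ih => rw [pow_succ', mul_apply_eq_comp, hV, ih]
  have hWVn : ∀ n x, (W ^ n) ((V ^ n) x) = x := fun n x => by
    induction n with
    | zero => simp
    | succ n ih => rw [pow_succ, mul_apply_eq_comp, pow_succ' V, mul_apply_eq_comp, hWV, ih]
  have key : ∀ x, ∀ ε > 0, ∀ᶠ n in atTop, ∃ y, ‖y - x‖ < ε ∧ (S ^ n) y = 0 := by
    intro x ε hε
    obtain ⟨m, hm⟩ := ((tendsto_zero_iff_norm_tendsto_zero.1 (hW x)).eventually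
      (gt_mem_nhds (half_pos hε))).exists
    -- This small change puts `x'` in the kernel of `W ^ m`, so `m` steps bring it into `ker W`.
    set x' := x - (V ^ m) ((W ^ m) x) with hx'
    set z := (S ^ m) x' with hz
    have hWz : W z = 0 := by
      rw [hz, hS, leftInverse_shiftPerturbation_pow hWV, pow_succ', mul_apply_eq_comp, hx',
        map_sub, hWVn, sub_self, map_zero, smul_zero]
    have hlim : Tendsto (fun k => r ^ k * (‖z‖ / (M ^ m * η))) atTop (𝓝 0) := by
      simpa using (tendsto_pow_atTop_nhds_zero_of_lt_one hr hr1).mul_const (‖z‖ / (M ^ m * η))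
    obtain ⟨K, hK⟩ := eventually_atTop.1 (hlim.eventually (gt_mem_nhds (half_pos hε)))
    filter_upwards [eventually_ge_atTop (m + K + 1)] with n hn
    obtain ⟨k, rfl⟩ : ∃ k, n = k + 1 + m := ⟨n - 1 - m, by omega⟩
    set y := (S ^ (k + 1)) z with hy
    have hWy : W y = 0 := by
      rw [hy, hS, leftInverse_shiftPerturbation_pow hWV, pow_succ W, mul_apply_eq_comp, hWz, map_zero,
        smul_zero]
    have hSx : (S ^ (k + 1 + m)) x' = y := by rw [pow_add, mul_apply_eq_comp]
    have hc : ((M : 𝕜) ^ (k + m + 1) * (η : 𝕜)) ≠ 0 :=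
      mul_ne_zero (pow_ne_zero _ (RCLike.ofReal_ne_zero.2 hM0.ne')) (RCLike.ofReal_ne_zero.2 hη.ne')
    -- The correction `u` reaches `y` at the same time as `x'`, so `x' - u` is annihilated. The
    -- factor `M ^ (k + 1)` cancels in its norm, leaving `r ^ (k + 1)`.
    set u := ((M : 𝕜) ^ (k + m + 1) * (η : 𝕜))⁻¹ • (V ^ (k + m + 1)) y with hu
    have hSu : (S ^ (k + 1 + m)) u = y := by
      rw [hu, map_smul, Nat.add_right_comm k 1 m, hS, shiftPerturbation_pow_succ_isometry_pow hWV _ hWy,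
        smul_smul, inv_mul_cancel₀ hc, one_smul]
    have hun : ‖u‖ < ε / 2 := by
      refine lt_of_le_of_lt ?_ (hK (k + 1) (by omega))
      rw [hu, norm_smul, hVn, norm_inv, norm_mul, norm_pow, RCLike.norm_ofReal, RCLike.norm_ofReal,
        abs_of_pos hM0, abs_of_pos hη]
      have h1 : ‖y‖ ≤ (r * M) ^ (k + 1) * ‖z‖ :=
        norm_shiftPerturbation_pow_of_ker hWV hP hT hr _ hWz
      calc (M ^ (k + m + 1) * η)⁻¹ * ‖y‖
          ≤ (M ^ (k + m + 1) * η)⁻¹ * ((r * M) ^ (k + 1) * ‖z‖) := by gcongr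
        _ = r ^ (k + 1) * (‖z‖ / (M ^ m * η)) := by
          rw [mul_pow, show k + m + 1 = (k + 1) + m by ring, pow_add M]
          field_simp
    refine ⟨x' - u, ?_, by rw [map_sub, hSx, hSu, sub_self]⟩
    have h2 : x' - u - x = -((V ^ m) ((W ^ m) x) + u) := by rw [hx']; abel
    rw [h2, norm_neg]
    have h3 := norm_add_le ((V ^ m) ((W ^ m) x)) u
    rw [hVn] at h3
    linarith
  intro N
  have hpos : (0 : ℝ) < 1 / ((N : ℝ) + 1) := Nat.one_div_pos_of_nat
  obtain ⟨p, hp⟩ := ((Filter.eventually_all_finite (Set.finite_Iic N)).2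
    fun i _ => key (d i) _ hpos).exists
  refine ⟨p, fun i hi => ?_⟩
  obtain ⟨y, hy, hy0⟩ := hp i hi
  exact ⟨y, hy, by rwa [hy0, norm_zero]⟩

end Model

/-! ### Gδ conditions and strong* approximation -/

section StrongStar

variable {𝕜 X : Type*} [RCLike 𝕜] [NormedAddCommGroup X] [InnerProductSpace 𝕜 X]

/-- Composition is jointly strongly continuous on norm-bounded sets; the bound `M` absorbs the
moving outer factor. -/
theorem continuous_pow_apply {α : Type*} [TopologicalSpace α] {A : α → X →L[𝕜] X} {M : ℝ}
    (hA : ∀ a, ‖A a‖ ≤ M) (hc : ∀ x, Continuous fun a => A a x) (n : ℕ) (x : X) :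
    Continuous fun a => (A a ^ n) x := by
  induction n with
  | zero => exact continuous_const
  | succ n ih =>
    refine continuous_iff_continuousAt.2 fun a => ?_
    have h1 : Tendsto (fun b => M * ‖(A b ^ n) x - (A a ^ n) x‖ +
        ‖A b ((A a ^ n) x) - A a ((A a ^ n) x)‖) (𝓝 a) (𝓝 0) := by
      have h2 := tendsto_iff_norm_sub_tendsto_zero.1 (ih.tendsto a)
      have h3 := tendsto_iff_norm_sub_tendsto_zero.1 ((hc ((A a ^ n) x)).tendsto a)
      simpa using (h2.const_mul M).add h3
    refine tendsto_iff_norm_sub_tendsto_zero.2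
      (squeeze_zero (fun _ => norm_nonneg _) (fun b => ?_) h1)
    simp only [pow_succ', mul_apply_eq_comp]
    have h4 := (A b).le_of_opNorm_le (hA b) ((A b ^ n) x - (A a ^ n) x)
    rw [map_sub] at h4
    linarith [norm_sub_le_norm_sub_add_norm_sub (A b ((A b ^ n) x)) (A b ((A a ^ n) x))
      (A a ((A a ^ n) x))]

theorem isGδ_setOf_hasSmallPowers {α : Type*} [TopologicalSpace α] {A : α → X →L[𝕜] X} {M : ℝ}
    (hA : ∀ a, ‖A a‖ ≤ M) (hc : ∀ x, Continuous fun a => A a x) (d : ℕ → X) :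
    IsGδ {a | HasSmallPowers d (A a)} := by
  have : {a | HasSmallPowers d (A a)} = ⋂ N : ℕ, ⋃ p : ℕ, ⋂ i ∈ Set.Iic N, ⋃ y : X,
      {a | ‖y - d i‖ < 1 / ((N : ℝ) + 1) ∧ ‖(A a ^ p) y‖ < 1 / ((N : ℝ) + 1)} := by
    ext a
    simp [HasSmallPowers]
  rw [this]
  refine IsGδ.iInter_of_isOpen fun N => isOpen_iUnion fun p =>
    (Set.finite_Iic N).isOpen_biInter fun i _ => isOpen_iUnion fun y => ?_
  exact isOpen_const.inter (isOpen_lt (continuous_pow_apply hA hc p y).norm continuous_const)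

theorem isGδ_setOf_hasUnboundedPowers {α : Type*} [TopologicalSpace α] {A : α → X →L[𝕜] X}
    {M : ℝ} (hA : ∀ a, ‖A a‖ ≤ M) (hc : ∀ x, Continuous fun a => A a x) :
    IsGδ {a | HasUnboundedPowers (A a)} := by
  have : {a | HasUnboundedPowers (A a)} = ⋂ N : ℕ, ⋃ q : ℕ, ⋃ x : X,
      {a | (N : ℝ) * ‖x‖ < ‖(A a ^ q) x‖} := by
    ext a
    simp [HasUnboundedPowers]
  rw [this]
  exact IsGδ.iInter_of_isOpen fun N => isOpen_iUnion fun q => isOpen_iUnion fun x =>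
    isOpen_lt continuous_const (continuous_pow_apply hA hc q x).norm

variable [CompleteSpace X] {V W T : X →L[𝕜] X} {M r η : ℝ}

theorem norm_sq_add_of_adjoint (hW : W = ContinuousLinearMap.adjoint V) (hV : ∀ x, ‖V x‖ = ‖x‖)
    {a : X} (ha : W a = 0) (b : X) : ‖a + V b‖ ^ 2 = ‖a‖ ^ 2 + ‖b‖ ^ 2 := by
  have h : inner 𝕜 a (V b) = 0 := by
    rw [← ContinuousLinearMap.adjoint_inner_left, ← hW, ha, inner_zero_left]
  rw [norm_add_sq (𝕜 := 𝕜), h, map_zero, hV]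
  ring

theorem norm_sq_sub_isometry (hW : W = ContinuousLinearMap.adjoint V) (hV : ∀ x, ‖V x‖ = ‖x‖)
    (hWV : ∀ x, W (V x) = x) (x : X) : ‖x - V (W x)‖ ^ 2 = ‖x‖ ^ 2 - ‖W x‖ ^ 2 := by
  have h := norm_sq_add_of_adjoint hW hV (a := x - V (W x)) (by rw [map_sub, hWV, sub_self]) (W x)
  rw [sub_add_cancel] at h
  linarith

theorem norm_sub_isometry_le (hW : W = ContinuousLinearMap.adjoint V) (hV : ∀ x, ‖V x‖ = ‖x‖)
    (hWV : ∀ x, W (V x) = x) (x : X) : ‖x - V (W x)‖ ≤ ‖x‖ := by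
  have h := norm_sq_sub_isometry hW hV hWV x
  exact le_of_sq_le_sq (by nlinarith [sq_nonneg ‖W x‖]) (norm_nonneg x)

/-- The output splits orthogonally along `ker W` and the range of `V`. Cauchy–Schwarz with `r² + η²
= 1` bounds the first part, and the identities `‖Px‖² = ‖x‖² - ‖Wx‖²`, at `x` and at `W x`, make the
sum telescope to at most `M² ‖x‖²`. -/
theorem norm_shiftPerturbation_le (hW : W = ContinuousLinearMap.adjoint V)
    (hV : ∀ x, ‖V x‖ = ‖x‖) (hWV : ∀ x, W (V x) = x) (hT : ‖T‖ ≤ M) (hr : 0 ≤ r) (hη : 0 ≤ η)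
    (hrη : r ^ 2 + η ^ 2 = 1) : ‖shiftPerturbation V W T M r η‖ ≤ M := by
  have hM : 0 ≤ M := (norm_nonneg T).trans hT
  refine ContinuousLinearMap.opNorm_le_bound _ hM fun x => ?_
  have h1 := norm_sq_sub_isometry hW hV hWV x
  have h2 := norm_sq_sub_isometry hW hV hWV (W x)
  set a := (r : 𝕜) • (T (x - V (W x)) - V (W (T (x - V (W x))))) +
    ((M * η : ℝ) : 𝕜) • (W x - V (W (W x))) with ha
  have hSx : shiftPerturbation V W T M r η x = a + V ((M : 𝕜) • W (W x)) := by
    rw [shiftPerturbation_apply, ha, map_smul, smul_add, smul_smul, RCLike.ofReal_mul, add_assoc]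
  have hWa : W a = 0 := by simp [ha, hWV]
  have hna : ‖a‖ ≤ M * (r * ‖x - V (W x)‖ + η * ‖W x - V (W (W x))‖) := by
    refine (norm_add_le _ _).trans ?_
    rw [norm_smul, norm_smul, RCLike.norm_ofReal, RCLike.norm_ofReal, abs_of_nonneg hr,
      abs_of_nonneg (mul_nonneg hM hη), mul_add]
    have h3 := (norm_sub_isometry_le hW hV hWV (T (x - V (W x)))).trans
      (T.le_of_opNorm_le hT _)
    have h4 := mul_le_mul_of_nonneg_left h3 hr
    linarith
  have hsq : ‖a‖ ^ 2 ≤ M ^ 2 * (‖x - V (W x)‖ ^ 2 + ‖W x - V (W (W x))‖ ^ 2) := by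
    refine (pow_le_pow_left₀ (norm_nonneg a) hna 2).trans ?_
    rw [mul_pow]
    refine mul_le_mul_of_nonneg_left ?_ (sq_nonneg M)
    generalize ‖x - V (W x)‖ = s
    generalize ‖W x - V (W (W x))‖ = t
    calc (r * s + η * t) ^ 2 ≤ (r ^ 2 + η ^ 2) * (s ^ 2 + t ^ 2) := by
          nlinarith [sq_nonneg (r * t - η * s)]
      _ = s ^ 2 + t ^ 2 := by rw [hrη, one_mul]
  have h5 := norm_sq_add_of_adjoint hW hV hWa ((M : 𝕜) • W (W x))
  rw [norm_smul, RCLike.norm_ofReal, abs_of_nonneg hM, mul_pow] at h5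
  rw [hSx]
  refine le_of_sq_le_sq ?_ (mul_nonneg hM (norm_nonneg x))
  rw [h5, mul_pow]
  rw [h1, h2] at hsq
  linarith

theorem adjoint_shiftPerturbation_apply (hW : W = ContinuousLinearMap.adjoint V) (x : X) :
    ContinuousLinearMap.adjoint (shiftPerturbation V W T M r η) x =
      (r : 𝕜) • (ContinuousLinearMap.adjoint T (x - V (W x)) -
        V (W (ContinuousLinearMap.adjoint T (x - V (W x))))) +
      (M : 𝕜) • V ((η : 𝕜) • (x - V (W x)) + V (W x)) := by
  have hW' : star V = W := hW.symm
  have hV' : star W = V := by rw [← hW', star_star]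
  rw [← ContinuousLinearMap.star_eq_adjoint, ← ContinuousLinearMap.star_eq_adjoint]
  simp [shiftPerturbation, star_add, star_mul, star_smul, hW', hV']

/-- Sequences of shift perturbations with vanishing coupling converge strong*-wise. -/
theorem tendsto_shiftPerturbation {V W : ℕ → X →L[𝕜] X}
    (hW : ∀ n, W n = ContinuousLinearMap.adjoint (V n)) (hV : ∀ n x, ‖V n x‖ = ‖x‖)
    (hW0 : ∀ x, Tendsto (fun n => W n x) atTop (𝓝 0)) {r η : ℕ → ℝ}
    (hr : Tendsto r atTop (𝓝 1)) (hη : Tendsto η atTop (𝓝 0)) (T : X →L[𝕜] X) (M : ℝ) (x : X) :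
    Tendsto (fun n => shiftPerturbation (V n) (W n) T M (r n) (η n) x) atTop (𝓝 (T x)) ∧
      Tendsto (fun n => ContinuousLinearMap.adjoint
        (shiftPerturbation (V n) (W n) T M (r n) (η n)) x) atTop
        (𝓝 (ContinuousLinearMap.adjoint T x)) := by
  have hWn : ∀ n, ‖W n‖ ≤ 1 := fun n => by
    rw [hW, LinearIsometryEquiv.norm_map]
    exact ContinuousLinearMap.opNorm_le_bound _ zero_le_one fun x => by rw [hV, one_mul]
  have hWy : ∀ {y : ℕ → X} {z : X}, Tendsto y atTop (𝓝 z) →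
      Tendsto (fun n => W n (y n)) atTop (𝓝 0) := by
    intro y z hy
    have h1 : Tendsto (fun n => W n (y n - z)) atTop (𝓝 0) :=
      squeeze_zero_norm (fun n => ((W n).le_of_opNorm_le (hWn n) _).trans (one_mul _).le)
        (tendsto_iff_norm_sub_tendsto_zero.1 hy)
    simpa using h1.add (hW0 z)
  have hVy : ∀ {y : ℕ → X}, Tendsto y atTop (𝓝 0) →
      Tendsto (fun n => V n (y n)) atTop (𝓝 0) := fun hy =>
    squeeze_zero_norm (fun n => (hV n _).le) (tendsto_zero_iff_norm_tendsto_zero.1 hy)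
  -- The projections `1 - V n * W n` tend strongly to the identity, even along convergent arguments.
  have hPy : ∀ {y : ℕ → X} {z : X}, Tendsto y atTop (𝓝 z) →
      Tendsto (fun n => y n - V n (W n (y n))) atTop (𝓝 z) := fun hy => by
    simpa using hy.sub (hVy (hWy hy))
  have hr' : Tendsto (fun n => (r n : 𝕜)) atTop (𝓝 1) := by
    simpa [Function.comp_def] using (RCLike.continuous_ofReal (K := 𝕜)).continuousAt.tendsto.comp hr
  have hη' : Tendsto (fun n => (η n : 𝕜)) atTop (𝓝 0) := by
    simpa [Function.comp_def] using (RCLike.continuous_ofReal (K := 𝕜)).continuousAt.tendsto.comp hη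
  have hx : Tendsto (fun _ : ℕ => x) atTop (𝓝 x) := tendsto_const_nhds
  have hmain : ∀ A : X →L[𝕜] X, Tendsto (fun n => (r n : 𝕜) • (A (x - V n (W n x)) -
      V n (W n (A (x - V n (W n x)))))) atTop (𝓝 (A x)) := fun A => by
    simpa using hr'.smul (hPy ((A.continuous.tendsto x).comp (hPy hx)))
  constructor
  · simp only [shiftPerturbation_apply]
    have h := ((hη'.smul (hPy (hWy hx))).add (hVy (hWy (hWy hx)))).const_smul (M : 𝕜)
    simpa using (hmain T).add h
  · simp only [adjoint_shiftPerturbation_apply (hW _)]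
    have h1 : Tendsto (fun n => (η n : 𝕜) • (x - V n (W n x)) + V n (W n x)) atTop (𝓝 0) := by
      simpa using (hη'.smul (hPy hx)).add (hVy (hWy hx))
    have h := (hVy h1).const_smul (M : 𝕜)
    simpa using (hmain (ContinuousLinearMap.adjoint T)).add h

theorem exists_seq_tendsto_powers [TopologicalSpace.SeparableSpace X]
    (hX : ¬ FiniteDimensional 𝕜 X) (hM : 1 < M) (hT : ‖T‖ ≤ M) (d : ℕ → X) :
    ∃ S : ℕ → X →L[𝕜] X, (∀ n, ‖S n‖ ≤ M ∧ HasSmallPowers d (S n) ∧ HasUnboundedPowers (S n)) ∧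
      ∀ x, Tendsto (fun n => S n x) atTop (𝓝 (T x)) ∧
        Tendsto (fun n => ContinuousLinearMap.adjoint (S n) x) atTop
          (𝓝 (ContinuousLinearMap.adjoint T x)) := by
  have : Nontrivial X := by
    by_contra h
    rw [not_nontrivial_iff_subsingleton] at h
    exact hX inferInstance
  obtain ⟨U, hU⟩ := exists_unilateral_shift hX
  -- Growing powers of one shift make `W n` tend to zero strongly, while for each fixed `n` the
  -- powers of `W n` also tend to zero.
  let V : ℕ → X →L[𝕜] X := fun n => U.toContinuousLinearMap ^ (n + 1)
  let W : ℕ → X →L[𝕜] X := fun n => ContinuousLinearMap.adjoint U.toContinuousLinearMap ^ (n + 1)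
  have hW : ∀ n, W n = ContinuousLinearMap.adjoint (V n) := fun n => by
    simp only [W, V, ← ContinuousLinearMap.star_eq_adjoint, star_pow]
  have hV : ∀ n x, ‖V n x‖ = ‖x‖ := by
    have h : ∀ n x, ‖(U.toContinuousLinearMap ^ n) x‖ = ‖x‖ := fun n x => by
      induction n with
      | zero => rfl
      | succ n ih =>
        rw [pow_succ', mul_apply_eq_comp]
        exact (U.norm_map _).trans ih
    exact fun n => h _
  have hWV : ∀ n x, W n (V n x) = x := fun n x => by
    have h := (ContinuousLinearMap.norm_map_iff_adjoint_comp_self (V n)).1 (hV n)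
    rw [hW]
    exact DFunLike.congr_fun h x
  have hW0 : ∀ x, Tendsto (fun n => W n x) atTop (𝓝 0) := fun x =>
    (hU x).comp (tendsto_add_atTop_nat 1)
  have hWk : ∀ n x, Tendsto (fun k => (W n ^ k) x) atTop (𝓝 0) := fun n x => by
    simp only [W, ← pow_mul]
    exact (hU x).comp (tendsto_id.const_mul_atTop' n.succ_pos)
  let η : ℕ → ℝ := fun n => 1 / ((n : ℝ) + 1)
  let r : ℕ → ℝ := fun n => √(1 - η n ^ 2)
  have hη0 : ∀ n, 0 < η n := fun n => Nat.one_div_pos_of_nat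
  have hη1 : ∀ n, η n ≤ 1 := fun n => by
    rw [div_le_one (by positivity)]
    linarith [n.cast_nonneg (α := ℝ)]
  have hrη : ∀ n, r n ^ 2 + η n ^ 2 = 1 := fun n => by
    rw [Real.sq_sqrt (by nlinarith [hη0 n, hη1 n])]
    ring
  have hr1 : ∀ n, r n < 1 := fun n => by
    rw [Real.sqrt_lt' one_pos]
    nlinarith [hη0 n]
  have hη : Tendsto η atTop (𝓝 0) := tendsto_one_div_add_atTop_nhds_zero_nat
  have hr : Tendsto r atTop (𝓝 1) := by
    simpa using ((hη.pow 2).const_sub 1).sqrt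
  refine ⟨fun n => shiftPerturbation (V n) (W n) T M (r n) (η n), fun n => ⟨?_, ?_, ?_⟩, fun x => ?_⟩
  · exact norm_shiftPerturbation_le (hW n) (hV n) (hWV n) hT (Real.sqrt_nonneg _) (hη0 n).le (hrη n)
  · exact hasSmallPowers_shiftPerturbation (hV n) (hWV n)
      (norm_sub_isometry_le (hW n) (hV n) (hWV n)) (hWk n) hT hM (Real.sqrt_nonneg _) (hr1 n)
      (hη0 n) d
  · exact hasUnboundedPowers_shiftPerturbation (hV n) (hWV n) hM
  · exact tendsto_shiftPerturbation hW hV hW0 hr hη T M x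

end StrongStar

theorem mainTheorem8 {𝕜 X : Type*} [RCLike 𝕜] [NormedAddCommGroup X] [InnerProductSpace 𝕜 X]
    [CompleteSpace X] [TopologicalSpace.SeparableSpace X] (hX : ¬ FiniteDimensional 𝕜 X)
    (M : ℝ) (hM : 1 < M) :
    @Dense (operatorBall 𝕜 X M) (strongStarBallTopology 𝕜 X M)
      {T : operatorBall 𝕜 X M | (T : X →L[𝕜] X) ∈ DULYC 𝕜 X} ∧
    @IsGδ (operatorBall 𝕜 X M) (strongStarBallTopology 𝕜 X M)
      {T : operatorBall 𝕜 X M | (T : X →L[𝕜] X) ∈ DULYC 𝕜 X} := by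
  let τ : TopologicalSpace (operatorBall 𝕜 X M) := strongStarBallTopology 𝕜 X M
  have hind : IsInducing fun (T : operatorBall 𝕜 X M) (x : X) =>
      ((T : X →L[𝕜] X) x, ContinuousLinearMap.adjoint (T : X →L[𝕜] X) x) :=
    ⟨by rw [← Function.comp_def (fun (T : X →L[𝕜] X) (x : X) =>
      (T x, ContinuousLinearMap.adjoint T x)) Subtype.val, ← induced_compose]⟩
  have hd := TopologicalSpace.denseRange_denseSeq X
  have hset : {T : operatorBall 𝕜 X M | (T : X →L[𝕜] X) ∈ DULYC 𝕜 X} =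
      {T : operatorBall 𝕜 X M | HasSmallPowers (TopologicalSpace.denseSeq X) (T : X →L[𝕜] X)} ∩
      {T : operatorBall 𝕜 X M | HasUnboundedPowers (T : X →L[𝕜] X)} := by
    ext T
    exact ⟨fun h => ⟨.of_scrambled h, .of_scrambled h⟩,
      fun h => isDenselyUniformlyLiYorkeChaotic_of_powers hd h.1 h.2⟩
  rw [hset]
  constructor
  · intro T
    obtain ⟨S, hS, hST⟩ := exists_seq_tendsto_powers hX hM T.2 (TopologicalSpace.denseSeq X)
    refine mem_closure_of_tendsto (b := atTop)
      (f := fun n => (⟨S n, (hS n).1⟩ : operatorBall 𝕜 X M)) ?_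
      (Eventually.of_forall fun n => (hS n).2)
    rw [hind.tendsto_nhds_iff, tendsto_pi_nhds]
    exact fun x => (hST x).1.prodMk_nhds (hST x).2
  · have hc : ∀ x, Continuous fun T : operatorBall 𝕜 X M => (T : X →L[𝕜] X) x := fun x =>
      continuous_fst.comp ((continuous_apply x).comp hind.continuous)
    have hA : ∀ T : operatorBall 𝕜 X M, ‖(T : X →L[𝕜] X)‖ ≤ M := fun T => T.2
    exact (isGδ_setOf_hasSmallPowers hA hc _).inter (isGδ_setOf_hasUnboundedPowers hA hc)
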